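/- Let $\mathbb K$ be an algebraically closed field of characteristic $0$ (for instance $\mathbb K=\mathbb C$), let $n\ge 0$ and $N=2n+1$. Let $\mathfrak g$ be $\mathfrak{gl}(N)$ or $\mathfrak{sl}(N)$ over $\mathbb K$, acting on the space $\Lambda^2(V)$, $\dim V=N$, of skew-symmetric $N\times N$ matrices $Q$ by the differential of the congruence action $Q\mapsto PQP^{T}$, that is, $\rho(X)Q=XQ+QX^{T}$. For $Q\in\Lambda^2(V)$ let $R_Q:\mathfrak g\to\Lambda^2(V)$, $R_Q(X)=\rho(X)Q$. Put $\delta=1$ for $\mathfrak{gl}(N)$ and $\delta=0$ for $\mathfrak{sl}(N)$. By the Jordan--Kronecker normal form, every pencil $A+\lambda B$ of linear maps $A,B:U\to W$ between finite-dimensional spaces is, in suitable bases of $U$ and $W$, block-diagonal with blocks of the following kinds: Jordan blocks with an eigenvalue in $\mathbb K\cup\{\infty\}$; horizontal Kronecker blocks, of size $(h-1)\times h$ with $h\ge 1$, with $\lambda$ on the diagonal and $1$ on the superdiagonal; vertical Kronecker blocks, of size $v\times(v-1)$ with $v\ge 1$, with $\lambda$ on the diagonal and $1$ on the subdiagonal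 (a zero block is regarded as a sum of $0\times1$ and $1\times 0$ blocks). The widths $h$ and heights $v$ are the horizontal and vertical indices. The Jordan--Kronecker invariants of $\rho$ are the horizontal and vertical indices, together with the sizes of the Jordan blocks grouped by distinct eigenvalue, of the pencil $R_Q+\lambda R_B$ for a generic pair, i.e. for all $(Q,B)$ in some non-empty Zariski open subset of $\Lambda^2(V)\times\Lambda^2(V)$. Then the Jordan--Kronecker invariants of $\rho$ consist of exactly $n(2n+3)+\delta$ horizontal indices $$\underbrace{1,\dots,1}_{2n+\delta},\qquad \underbrace{2,\dots,2}_{n(2n+1)};$$ there are no vertical indices and no Jordan blocks. -/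

import Mathlib

/-! ### Jordan–Kronecker normal form of a pair of linear maps -/

/-- The blocks of the Jordan–Kronecker normal form of a pencil `A + lambda B`.
A Jordan block carries an eigenvalue in `K ∪ {∞}` and its size; a horizontal block carries its
width and a vertical block carries its height.  All these numbers are positive in a normal form. -/
inductive JKBlock (K : Type*) where
  | jordan (μ : OnePoint K) (k : ℕ) : JKBlock K
  | horizontal (h : ℕ) : JKBlock K
  | vertical (v : ℕ) : JKBlock K

namespace JKBlock

variable {K : Type*}

/-- Size of a Jordan block, width of a horizontal block, height of a vertical block. -/
def size : JKBlock K → ℕ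
  | jordan _ k => k
  | horizontal h => h
  | vertical v => v

/-- Number of rows: a horizontal block of width `h` is an `(h - 1) × h` block. -/
def rows : JKBlock K → ℕ
  | jordan _ k => k
  | horizontal h => h - 1
  | vertical v => v

/-- Number of columns: a vertical block of height `v` is a `v × (v - 1)` block. -/
def cols : JKBlock K → ℕ
  | jordan _ k => k
  | horizontal h => h
  | vertical v => v - 1

/-- Entry `(i, j)` of the block of the first map `A`. -/
def entryA [Zero K] [One K] : JKBlock K → ℕ → ℕ → K
  | jordan (some μ) _, i, j => if i = j then μ else if j = i + 1 then 1 else 0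
  | jordan none _, i, j => if i = j then 1 else 0
  | horizontal _, i, j => if j = i + 1 then 1 else 0
  | vertical _, i, j => if i = j + 1 then 1 else 0

/-- Entry `(i, j)` of the block of the second map `B`. -/
def entryB [Zero K] [One K] : JKBlock K → ℕ → ℕ → K
  | jordan (some _) _, i, j => if i = j then 1 else 0
  | jordan none _, i, j => if j = i + 1 then 1 else 0
  | horizontal _, i, j => if i = j then 1 else 0
  | vertical _, i, j => if i = j then 1 else 0

/-- The block of the first map `A`. -/
def matA [Zero K] [One K] (b : JKBlock K) : Matrix (Fin b.rows) (Fin b.cols) K :=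
  Matrix.of fun i j => b.entryA i j

/-- The block of the second map `B`. -/
def matB [Zero K] [One K] (b : JKBlock K) : Matrix (Fin b.rows) (Fin b.cols) K :=
  Matrix.of fun i j => b.entryB i j

/-- The eigenvalue (possibly `∞`) and the size of a Jordan block. -/
def jordanData? : JKBlock K → Option (OnePoint K × ℕ)
  | jordan μ k => some (μ, k)
  | _ => none

/-- The width of a horizontal block. -/
def horizontalIndex? : JKBlock K → Option ℕ
  | horizontal h => some h
  | _ => none

/-- The height of a vertical block. -/
def verticalIndex? : JKBlock K → Option ℕ
  | vertical v => some v
  | _ => none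

end JKBlock

/-- The discrete invariants of a pencil.  `jordan` has one member for each distinct eigenvalue
(in `K ∪ {∞}`), namely the multiset of sizes of the Jordan blocks with that eigenvalue;
`horizontal` and `vertical` are the multisets of horizontal and vertical indices. -/
@[ext]
structure AlgebraicType where
  jordan : Multiset (Multiset ℕ)
  horizontal : Multiset ℕ
  vertical : Multiset ℕ

open Classical in
/-- The algebraic type read off from the multiset of blocks of a normal form. -/
noncomputable def AlgebraicType.ofBlocks {K : Type*} (S : Multiset (JKBlock K)) :
    AlgebraicType where
  jordan :=
    ((S.filterMap JKBlock.jordanData?).map Prod.fst).dedup.map fun μ =>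
      ((S.filterMap JKBlock.jordanData?).filter fun d => d.1 = μ).map Prod.snd
  horizontal := S.filterMap JKBlock.horizontalIndex?
  vertical := S.filterMap JKBlock.verticalIndex?

/-- The pencil `A + lambda B` has algebraic type `T`: in suitable bases of `U` and `W` the
matrices of `A` and `B` are simultaneously block diagonal, the diagonal blocks are
Jordan–Kronecker blocks of positive size, and these blocks have type `T`.
(A zero block of the pencil consists of horizontal `0 × 1` and vertical `1 × 0` blocks.) -/
def HasAlgebraicType {K U W : Type*} [Field K] [AddCommGroup U] [Module K U]
    [AddCommGroup W] [Module K W] (A B : U →ₗ[K] W) (T : AlgebraicType) : Prop :=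
  ∃ (ι : Type) (_ : Fintype ι) (_ : DecidableEq ι) (blk : ι → JKBlock K)
    (bU : Module.Basis (Σ i, Fin (blk i).cols) K U)
    (bW : Module.Basis (Σ i, Fin (blk i).rows) K W),
    (∀ i, 0 < (blk i).size) ∧
    LinearMap.toMatrix bU bW A = Matrix.blockDiagonal' (fun i => (blk i).matA) ∧
    LinearMap.toMatrix bU bW B = Matrix.blockDiagonal' (fun i => (blk i).matB) ∧
    AlgebraicType.ofBlocks (Finset.univ.val.map blk) = T

/-! ### Jordan–Kronecker invariants of a Lie algebra representation -/

/-- A property of points of a finite-dimensional vector space holds generically if it holds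
wherever some nonzero polynomial in the coordinates does not vanish
(that is, over an infinite field, on a nonempty Zariski open set). -/
def HoldsGenerically (K : Type*) {E : Type*} [Field K] [AddCommGroup E] [Module K E]
    (P : E → Prop) : Prop :=
  ∃ (m : ℕ) (e : Module.Basis (Fin m) K E) (p : MvPolynomial (Fin m) K), p ≠ 0 ∧
    ∀ x : E, MvPolynomial.eval (e.repr x) p ≠ 0 → P x

/- Endomorphisms and square matrices are Lie algebras under the commutator. -/
attribute [local instance 100] LieRing.ofAssociativeRing

/-- The operator `R_x : L → W`, `R_x ξ = ρ(ξ) x`. -/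
def repOperator {K L W : Type*} [Field K] [LieRing L] [LieAlgebra K L] [AddCommGroup W]
    [Module K W] (ρ : L →ₗ⁅K⁆ Module.End K W) (x : W) : L →ₗ[K] W :=
  (ρ : L →ₗ[K] Module.End K W).flip x

/-- `T` is the Jordan–Kronecker invariant of `ρ`: it is the algebraic type of the pencil
`R_a + lambda R_b` for a generic pair `(a, b)`. -/
def IsJKInvariant {K L W : Type*} [Field K] [LieRing L] [LieAlgebra K L] [AddCommGroup W]
    [Module K W] (ρ : L →ₗ⁅K⁆ Module.End K W) (T : AlgebraicType) : Prop :=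
  HoldsGenerically K fun ab : W × W =>
    HasAlgebraicType (repOperator ρ ab.1) (repOperator ρ ab.2) T

/-! ### The congruence representation on skew-symmetric forms -/

/-- Skew-symmetric forms, given by their matrices. -/
def skewForms (ι K : Type*) [Field K] : Submodule K (Matrix ι ι K) where
  carrier := {Q | Q.transpose = -Q}
  add_mem' {P Q} hP hQ := by
    simp only [Set.mem_ofPred_eq] at hP hQ ⊢
    rw [Matrix.transpose_add, hP, hQ, neg_add]
  zero_mem' := by simp
  smul_mem' c Q hQ := by
    simp only [Set.mem_ofPred_eq] at hQ ⊢
    rw [Matrix.transpose_smul, hQ, smul_neg]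

/-- The differential `ρ(X) Q = X Q + Q Xᵀ` of the congruence action `Q ↦ P Q Pᵀ`, as a
representation of `gl` on skew-symmetric forms. -/
def glCongr (ι K : Type*) [Field K] [Fintype ι] [DecidableEq ι] :
    Matrix ι ι K →ₗ⁅K⁆ Module.End K (skewForms ι K) where
  toFun X :=
    { toFun := fun Q => ⟨X * Q.1 + Q.1 * X.transpose, by
        have hQ : Q.1.transpose = -Q.1 := Q.2
        change (X * Q.1 + Q.1 * X.transpose).transpose = -(X * Q.1 + Q.1 * X.transpose)
        rw [Matrix.transpose_add, Matrix.transpose_mul, Matrix.transpose_mul,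
          Matrix.transpose_transpose, hQ, Matrix.neg_mul, Matrix.mul_neg]
        abel⟩
      map_add' := fun P Q => by
        ext1
        simp only [Submodule.coe_add, mul_add, add_mul]
        abel
      map_smul' := fun c Q => by
        ext1
        simp [smul_add] }
  map_add' X Y := by
    refine LinearMap.ext fun Q => Subtype.ext ?_
    simp only [LinearMap.coe_mk, AddHom.coe_mk, LinearMap.add_apply, Submodule.coe_add,
      Matrix.transpose_add, mul_add, add_mul]
    abel
  map_smul' c X := by
    refine LinearMap.ext fun Q => Subtype.ext ?_
    simp [smul_add]
  map_lie' {X Y} := by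
    refine LinearMap.ext fun Q => Subtype.ext ?_
    simp only [Ring.lie_def, LinearMap.coe_mk, AddHom.coe_mk, LinearMap.sub_apply,
      Module.End.mul_apply, Submodule.coe_sub, Matrix.transpose_sub, Matrix.transpose_mul]
    noncomm_ring

/-- The restriction of the congruence representation to `sl`. -/
def slCongr (ι K : Type*) [Field K] [Fintype ι] [DecidableEq ι] :
    LieAlgebra.SpecialLinear.sl ι K →ₗ⁅K⁆ Module.End K (skewForms ι K) :=
  (glCongr ι K).comp (LieAlgebra.SpecialLinear.sl ι K).incl

/-! The point is that `(R_Q, R_B) : 𝔤 → Λ² × Λ²` is onto for a generic pair. Lifting a basis of `Λ²`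
through each factor then gives `dim Λ² = n(2n+1)` blocks of width 2, and the kernel, of dimension
`dim 𝔤 - 2 dim Λ² = 2n + δ`, gives the blocks of width 1 (`hasAlgebraicType_of_surjective_prod`).

Surjectivity is an open condition (`holdsGenerically_surjective`), so one pair suffices. Take the
path `0 - 1 - ... - 2n` and let the two forms carry its alternate edges (`chainForm`). A functional
killing the image of `sl` pulls back to `gl` as a multiple `c` of the trace. Evaluating it on matrix
units gives recurrences for its values `p`, `q` on `e_k ∧ e_l` in the two factors, and
`eq_zero_of_skew_recurrence` forces `p = q = 0`. The case of `gl` follows since `sl ⊆ gl`. -/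

/-! ### Recurrences for a functional annihilating the tangent space -/

/-- Two skew families of scalars supported on indices at most `2 * n` vanish if they satisfy the
recurrences coming from a functional that annihilates the tangent space, modulo scalars, at the
standard odd-dimensional pair of skew forms. -/
theorem eq_zero_of_skew_recurrence {K : Type*} [Field K] [CharZero K] {n : ℕ}
    {p q : ℕ → ℕ → K} {c : K}
    (hp : ∀ k l, p k l = -p l k) (hq : ∀ k l, q k l = -q l k)
    (hp0 : ∀ k l, 2 * n < l → p k l = 0) (hq0 : ∀ k l, 2 * n < l → q k l = 0)
    (h0 : ∀ k, k ≤ 2 * n → p k 1 = if k = 0 then c else 0)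
    (h1 : ∀ k m, k ≤ 2 * n → m < n →
      p k (2 * m + 3) - q k (2 * m + 1) = if k = 2 * m + 2 then c else 0)
    (h2 : ∀ k m, k ≤ 2 * n → m < n →
      -p k (2 * m) + q k (2 * m + 2) = if k = 2 * m + 1 then c else 0) :
    (∀ k l, p k l = 0) ∧ ∀ k l, q k l = 0 := by
  have hp0' : ∀ k l, 2 * n < k → p k l = 0 := fun k l h => by rw [hp, hp0 _ _ h, neg_zero]
  have hq0' : ∀ k l, 2 * n < k → q k l = 0 := fun k l h => by rw [hq, hq0 _ _ h, neg_zero]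
  have self0 : ∀ x : K, x = -x → x = 0 := fun x h => by
    have : 2 * x = 0 := by linear_combination h
    simpa using this
  -- both indices odd
  have poo : ∀ m j, p (2 * j + 1) (2 * m + 1) = 0 := by
    intro m
    induction m with
    | zero =>
      intro j
      by_cases hj : 2 * j + 1 ≤ 2 * n
      · simpa using h0 _ hj
      · exact hp0' _ _ (by omega)
    | succ m ih =>
      intro j
      by_cases hj : 2 * j + 1 ≤ 2 * n
      · by_cases hm : m < n
        · have e1 := h1 (2 * j + 1) m hj hm
          have e2 := h1 (2 * m + 1) j (by omega) (by omega)
          rw [if_neg (by omega)] at e1 e2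
          have e3 := ih (j + 1)
          rw [show 2 * (j + 1) + 1 = 2 * j + 3 by ring, hp] at e3
          rw [show 2 * (m + 1) + 1 = 2 * m + 3 by ring]
          linear_combination e1 + hq (2 * j + 1) (2 * m + 1) + e2 + e3
        · exact hp0 _ _ (by omega)
      · exact hp0' _ _ (by omega)
  have qoo : ∀ m j, q (2 * j + 1) (2 * m + 1) = 0 := by
    intro m j
    by_cases hj : 2 * j + 1 ≤ 2 * n
    · by_cases hm : m < n
      · have e1 := h1 (2 * j + 1) m hj hm
        rw [if_neg (by omega)] at e1
        linear_combination poo (m + 1) j - e1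
      · exact hq0 _ _ (by omega)
    · exact hq0' _ _ (by omega)
  -- both indices even
  have pshift : ∀ d i j, i + d ≤ n → j + d ≤ n → p (2 * (i + d)) (2 * j) = p (2 * i) (2 * (j + d)) := by
    intro d
    induction d with
    | zero => intros; rfl
    | succ d ih =>
      intro i j hi hj
      have e0 := ih i (j + 1) (by omega) (by omega)
      have e1 := h2 (2 * (i + (d + 1))) j (by omega) (by omega)
      have e2 := h2 (2 * (j + 1)) (i + d) (by omega) (by omega)
      rw [if_neg (by omega)] at e1 e2
      rw [show j + (d + 1) = j + 1 + d by ring]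
      linear_combination -e1 + hq (2 * (i + (d + 1))) (2 * (j + 1)) - e2
        + e0 - hp (2 * (i + d)) (2 * (j + 1))
  -- On even indices `p` is constant along antidiagonals, which are symmetric under transposition,
  -- so skewness gives `x = -x`.
  have pee' : ∀ i d, i + d ≤ n → p (2 * (i + d)) (2 * i) = 0 := fun i d h =>
    self0 _ (by rw [← hp, pshift d i i h h])
  have pee : ∀ i j, p (2 * i) (2 * j) = 0 := by
    intro i j
    by_cases hi : i ≤ n
    · by_cases hj : j ≤ n
      · rcases le_total i j with h | h
        · obtain ⟨d, rfl⟩ := Nat.exists_eq_add_of_le h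
          rw [hp, pee' i d hj, neg_zero]
        · obtain ⟨d, rfl⟩ := Nat.exists_eq_add_of_le h
          exact pee' j d hi
      · exact hp0 _ _ (by omega)
    · exact hp0' _ _ (by omega)
  have qee1 : ∀ i j, q (2 * i) (2 * (j + 1)) = 0 := by
    intro i j
    by_cases hi : i ≤ n
    · by_cases hj : j < n
      · have e := h2 (2 * i) j (by omega) hj
        rw [if_neg (by omega)] at e
        linear_combination e + pee i j
      · exact hq0 _ _ (by omega)
    · exact hq0' _ _ (by omega)
  have qee : ∀ i j, q (2 * i) (2 * j) = 0 := by
    intro i j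
    -- `h2` does not reach column `0` of `q`; skewness does.
    rcases j with _ | j
    · rcases i with _ | i
      · exact self0 _ (hq _ _)
      · rw [hq, qee1 0 i, neg_zero]
    · exact qee1 i j
  -- indices of different parity
  have qeo : ∀ i m, i < n → m < n →
      q (2 * (i + 1)) (2 * m + 1) = p (2 * i) (2 * m + 1) - if i = m then c else 0 := by
    intro i m hi hm
    have e := h2 (2 * m + 1) i (by omega) hi
    have e' : (if 2 * m + 1 = 2 * i + 1 then c else 0) = if i = m then c else 0 := by
      congr 1; simp [eq_comm]
    rw [e'] at e
    linear_combination hq (2 * (i + 1)) (2 * m + 1) - e - hp (2 * m + 1) (2 * i)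
  -- The terms `c` coming from `h1` and from `h2` (through `qeo`) cancel.
  have pstep : ∀ i m, i < n → m < n →
      p (2 * (i + 1)) (2 * (m + 1) + 1) = p (2 * i) (2 * m + 1) := by
    intro i m hi hm
    have e := h1 (2 * (i + 1)) m (by omega) hm
    have e' : (if 2 * (i + 1) = 2 * m + 2 then c else 0) = if i = m then c else 0 := by
      congr 1; exact propext (by omega)
    rw [e'] at e
    linear_combination e + qeo i m hi hm
  -- Diagonal shifts lead to column `2n + 1`, out of range, whatever `c` is; since `p 0 1 = c`, this
  -- also forces `c = 0`.
  have pup : ∀ d i m, i ≤ m → m + d = n → p (2 * i) (2 * m + 1) = 0 := by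
    intro d
    induction d with
    | zero => intro i m _ h; exact hp0 _ _ (by omega)
    | succ d ih =>
      intro i m h h'
      rw [← pstep i m (by omega) (by omega)]
      exact ih _ _ (by omega) (by omega)
  have hc : c = 0 := by
    have e := h0 0 (by omega)
    rw [if_pos rfl] at e
    rw [← e]
    exact pup n 0 0 le_rfl (by omega)
  subst hc
  simp only [ite_self, sub_zero] at *
  -- Here the shifts run backwards, to column `1`, where `h0` applies.
  have pdown : ∀ m i, m < i → i ≤ n → p (2 * i) (2 * m + 1) = 0 := by
    intro m
    induction m with
    | zero => intro i _ h; exact h0 _ (by omega)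
    | succ m ih =>
      intro i h h'
      obtain ⟨i, rfl⟩ : ∃ j, i = j + 1 := ⟨i - 1, by omega⟩
      rw [pstep i m (by omega) (by omega)]
      exact ih _ (by omega) (by omega)
  have peo : ∀ i m, p (2 * i) (2 * m + 1) = 0 := by
    intro i m
    by_cases hi : i ≤ n
    · by_cases hm : m ≤ n
      · rcases le_or_gt i m with h | h
        · exact pup (n - m) i m h (by omega)
        · exact pdown m i h hi
      · exact hp0 _ _ (by omega)
    · exact hp0' _ _ (by omega)
  have qeo' : ∀ i m, q (2 * i) (2 * m + 1) = 0 := by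
    intro i m
    by_cases hi : i ≤ n
    · by_cases hm : m < n
      · rcases i with _ | i
        · have e := h1 (2 * 0) m (by omega) hm
          linear_combination peo 0 (m + 1) - e
        · rw [qeo i m (by omega) hm, peo]
      · exact hq0 _ _ (by omega)
    · exact hq0' _ _ (by omega)
  constructor
  · intro k l
    obtain ⟨i, rfl | rfl⟩ := Nat.even_or_odd' k <;> obtain ⟨j, rfl | rfl⟩ := Nat.even_or_odd' l
    · exact pee i j
    · exact peo i j
    · rw [hp, peo, neg_zero]
    · exact poo j i
  · intro k l
    obtain ⟨i, rfl | rfl⟩ := Nat.even_or_odd' k <;> obtain ⟨j, rfl | rfl⟩ := Nat.even_or_odd' l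
    · exact qee i j
    · exact qeo' i j
    · rw [hq, qeo', neg_zero]
    · exact qoo j i

/-! ### Surjectivity is a generic property -/

/-- If `x ↦ Φ x` is a linear family of linear maps between finite-dimensional spaces and some
member is surjective, then the generic member is surjective. -/
theorem holdsGenerically_surjective {K E U Z : Type*} [Field K] [AddCommGroup E] [Module K E]
    [FiniteDimensional K E] [AddCommGroup U] [Module K U] [AddCommGroup Z] [Module K Z]
    [FiniteDimensional K Z] (Φ : E →ₗ[K] U →ₗ[K] Z) {x₀ : E}
    (hx₀ : Function.Surjective (Φ x₀)) :
    HoldsGenerically K fun x => Function.Surjective (Φ x) := by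
  classical
  obtain ⟨s, hs⟩ := (Φ x₀).exists_rightInverse_of_surjective (LinearMap.range_eq_top.2 hx₀)
  let e := Module.finBasis K E
  let b := Module.finBasis K Z
  let M : Fin (Module.finrank K E) → Matrix (Fin (Module.finrank K Z)) (Fin (Module.finrank K Z)) K :=
    fun i => LinearMap.toMatrix b b (Φ (e i) ∘ₗ s)
  -- Composing with a section of `Φ x₀` yields square matrices whose entries are linear forms in the
  -- coordinates of `x`; the determinant is `1` at `x₀`.
  let p : MvPolynomial (Fin (Module.finrank K E)) K :=
    (Matrix.of fun k l => ∑ i, MvPolynomial.X i * MvPolynomial.C (M i k l)).det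
  have hp : ∀ x, MvPolynomial.eval (e.repr x) p = LinearMap.det (Φ x ∘ₗ s) := by
    intro x
    rw [← LinearMap.det_toMatrix b, RingHom.map_det]
    congr 1
    ext k l
    have hx : Φ x ∘ₗ s = ∑ i, e.repr x i • (Φ (e i) ∘ₗ s) := by
      ext z
      conv_lhs => rw [← e.sum_repr x]
      simp only [map_sum, map_smul, LinearMap.comp_apply, LinearMap.sum_apply,
        LinearMap.smul_apply]
    rw [hx]
    simp [M, Matrix.sum_apply]
  refine ⟨_, e, p, ?_, ?_⟩
  · intro h
    have := hp x₀
    rw [h, hs] at this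
    simp at this
  · intro x hx
    rw [hp] at hx
    have hu : IsUnit (Φ x ∘ₗ s) :=
      (LinearMap.isUnit_iff_isUnit_det _).2 (isUnit_iff_ne_zero.2 hx)
    exact Function.Surjective.of_comp (g := s) ((Module.End.isUnit_iff _).1 hu).2

theorem HoldsGenerically.mono {K E : Type*} [Field K] [AddCommGroup E] [Module K E]
    {P P' : E → Prop} (h : HoldsGenerically K P) (hPP' : ∀ x, P x → P' x) :
    HoldsGenerically K P' := by
  obtain ⟨m, e, p, hp, hx⟩ := h
  exact ⟨m, e, p, hp, fun x h => hPP' x (hx x h)⟩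

/-! ### Normal form of a jointly surjective pair -/

theorem filterMap_replicate_of_eq_none {α β : Type*} {F : α → Option β} {x : α} {m : ℕ}
    (h : F x = none) : (Multiset.replicate m x).filterMap F = 0 := by
  induction m with
  | zero => simp
  | succ m ih => rw [Multiset.replicate_succ, Multiset.filterMap_cons_none _ _ h, ih]

theorem filterMap_replicate_of_eq_some {α β : Type*} {F : α → Option β} {x : α} {y : β} {m : ℕ}
    (h : F x = some y) : (Multiset.replicate m x).filterMap F = Multiset.replicate m y := by
  induction m with
  | zero => simp
  | succ m ih =>
    rw [Multiset.replicate_succ, Multiset.filterMap_cons_some _ _ _ h, ih, Multiset.replicate_succ]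

/-- A pencil `A + lambda B` for which `(A, B) : U → W × W` is surjective consists of `dim W`
horizontal blocks of width `2` and of horizontal blocks of width `1`. -/
theorem hasAlgebraicType_of_surjective_prod {K U W : Type*} [Field K] [AddCommGroup U]
    [Module K U] [FiniteDimensional K U] [AddCommGroup W] [Module K W] [FiniteDimensional K W]
    {A B : U →ₗ[K] W} (h : Function.Surjective (A.prod B)) {r w : ℕ}
    (hw : Module.finrank K W = w) (hU : Module.finrank K U = 2 * w + r) :
    HasAlgebraicType A B ⟨0, Multiset.replicate r 1 + Multiset.replicate w 2, 0⟩ := by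
  classical
  let b : Module.Basis (Fin w) K W := Module.finBasisOfFinrankEq K W hw
  have hk : Module.finrank K (LinearMap.ker (A.prod B)) = r := by
    have := (A.prod B).finrank_range_add_finrank_ker
    rw [LinearMap.range_eq_top.2 h, finrank_top, Module.finrank_prod] at this
    omega
  let z : Module.Basis (Fin r) K (LinearMap.ker (A.prod B)) := Module.finBasisOfFinrankEq K _ hk
  have hzA : ∀ j, A (z j) = 0 := fun j => congrArg Prod.fst (LinearMap.mem_ker.1 (z j).2)
  have hzB : ∀ j, B (z j) = 0 := fun j => congrArg Prod.snd (LinearMap.mem_ker.1 (z j).2)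
  choose f hf using fun i => h (b i, 0)
  choose g hg using fun i => h (0, b i)
  have hfA : ∀ i, A (f i) = b i := fun i => congrArg Prod.fst (hf i)
  have hfB : ∀ i, B (f i) = 0 := fun i => congrArg Prod.snd (hf i)
  have hgA : ∀ i, A (g i) = 0 := fun i => congrArg Prod.fst (hg i)
  have hgB : ∀ i, B (g i) = b i := fun i => congrArg Prod.snd (hg i)
  let blk : Fin w ⊕ Fin r → JKBlock K := Sum.elim (fun _ => .horizontal 2) fun _ => .horizontal 1
  -- The block of width 2 is the row `(λ, 1)`: its column `0` belongs to `B`, hence `g`, and its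
  -- column `1` to `A`, hence `f`.
  let v : (Σ i, Fin (blk i).cols) → U
    | ⟨.inl i, k⟩ => if (k : ℕ) = 0 then g i else f i
    | ⟨.inr j, _⟩ => z j
  have hv : ⊤ ≤ Submodule.span K (Set.range v) := by
    have hvf : ∀ i, f i ∈ Submodule.span K (Set.range v) := fun i =>
      Submodule.subset_span ⟨⟨.inl i, (⟨1, by decide⟩ : Fin 2)⟩, rfl⟩
    have hvg : ∀ i, g i ∈ Submodule.span K (Set.range v) := fun i =>
      Submodule.subset_span ⟨⟨.inl i, (⟨0, by decide⟩ : Fin 2)⟩, rfl⟩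
    have hvz : ∀ u ∈ LinearMap.ker (A.prod B), u ∈ Submodule.span K (Set.range v) := by
      intro u hu
      have : u = ∑ j, z.repr ⟨u, hu⟩ j • (z j : U) := by
        have := congrArg (LinearMap.ker (A.prod B)).subtype (z.sum_repr ⟨u, hu⟩)
        rw [map_sum] at this
        exact this.symm
      rw [this]
      exact Submodule.sum_mem _ fun j _ => Submodule.smul_mem _ _ <|
        Submodule.subset_span ⟨⟨.inr j, (⟨0, by decide⟩ : Fin 1)⟩, rfl⟩
    intro u _
    have hu : u - ∑ i, b.repr (A u) i • f i - ∑ i, b.repr (B u) i • g i ∈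
        LinearMap.ker (A.prod B) := by
      rw [LinearMap.mem_ker]
      ext
      · simp [hfA, hgA, b.sum_repr]
      · simp [hfB, hgB, b.sum_repr]
    have hs : ∀ (a : Fin w → K) (y : Fin w → U), (∀ i, y i ∈ Submodule.span K (Set.range v)) →
        ∑ i, a i • y i ∈ Submodule.span K (Set.range v) := fun a y hy =>
      Submodule.sum_mem _ fun i _ => Submodule.smul_mem _ _ (hy i)
    have := add_mem (add_mem (hvz _ hu) (hs (b.repr (B u)) g hvg)) (hs (b.repr (A u)) f hvf)
    simpa using this
  have hcard : Fintype.card (Σ i, Fin (blk i).cols) = Module.finrank K U := by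
    rw [hU, Fintype.card_sigma, Fintype.sum_sum_type]
    change ∑ _ : Fin w, Fintype.card (Fin 2) + ∑ _ : Fin r, Fintype.card (Fin 1) = _
    simp [mul_comm]
  let bU := basisOfTopLeSpanOfCardEqFinrank v hv hcard
  -- Blocks of width 1 have no rows, so the rows are indexed by the blocks of width 2 alone.
  let eW : Fin w ≃ Σ i, Fin (blk i).rows :=
    { toFun := fun i => ⟨.inl i, (⟨0, by decide⟩ : Fin 1)⟩
      invFun := fun x => match x with
        | ⟨.inl i, _⟩ => i
        | ⟨.inr _, k⟩ => Fin.elim0 (show Fin 0 from k)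
      left_inv := fun _ => rfl
      right_inv := fun x => match x with
        | ⟨.inl i, (k : Fin 1)⟩ => by
          obtain rfl : k = 0 := Subsingleton.elim _ _
          rfl
        | ⟨.inr _, k⟩ => Fin.elim0 (show Fin 0 from k) }
  have hbU : ∀ x, bU x = v x := fun x => by simp [bU]
  have hrepr : ∀ i i' k, (b.reindex eW).repr (b i) ⟨.inl i', k⟩ = if i = i' then 1 else 0 := by
    intro i i' k
    rw [Module.Basis.repr_reindex_apply, Module.Basis.repr_self, Finsupp.single_apply]
    rfl
  refine ⟨Fin w ⊕ Fin r, inferInstance, inferInstance, blk, bU, b.reindex eW, ?_, ?_, ?_, ?_⟩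
  · rintro (i | j)
    · exact Nat.two_pos
    · exact Nat.one_pos
  · ext ⟨i, k⟩ ⟨j, l⟩
    rw [LinearMap.toMatrix_apply, hbU]
    rcases i with i | i
    · rcases j with j | j
      · have hl : (b.reindex eW).repr (A (v ⟨.inl j, l⟩)) ⟨.inl i, k⟩ =
            if (l : ℕ) = 0 then 0 else (if j = i then 1 else 0) := by
          change (b.reindex eW).repr (A (if (l : ℕ) = 0 then g j else f j)) ⟨.inl i, k⟩ = _
          by_cases h0 : (l : ℕ) = 0
          · simp only [h0, if_true, hgA, map_zero, Finsupp.zero_apply]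
          · simp only [h0, if_false, hfA, hrepr]
        rw [hl]
        by_cases hij : j = i
        · subst hij
          rw [Matrix.blockDiagonal'_apply_eq]
          change Fin 1 at k
          change Fin 2 at l
          obtain rfl : k = 0 := Subsingleton.elim _ _
          change _ = (if (l : ℕ) = 0 + 1 then 1 else 0)
          fin_cases l <;> simp
        · rw [Matrix.blockDiagonal'_apply_ne _ _ _ (by simpa using Ne.symm hij)]
          simp [hij]
      · rw [Matrix.blockDiagonal'_apply_ne _ _ _ (by simp)]
        simp [v, hzA]
    · exact Fin.elim0 (show Fin 0 from k)
  · ext ⟨i, k⟩ ⟨j, l⟩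
    rw [LinearMap.toMatrix_apply, hbU]
    rcases i with i | i
    · rcases j with j | j
      · have hl : (b.reindex eW).repr (B (v ⟨.inl j, l⟩)) ⟨.inl i, k⟩ =
            if (l : ℕ) = 0 then (if j = i then 1 else 0) else 0 := by
          change (b.reindex eW).repr (B (if (l : ℕ) = 0 then g j else f j)) ⟨.inl i, k⟩ = _
          by_cases h0 : (l : ℕ) = 0
          · simp only [h0, if_true, hgB, hrepr]
          · simp only [h0, if_false, hfB, map_zero, Finsupp.zero_apply]
        rw [hl]
        by_cases hij : j = i
        · subst hij
          rw [Matrix.blockDiagonal'_apply_eq]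
          change Fin 1 at k
          change Fin 2 at l
          obtain rfl : k = 0 := Subsingleton.elim _ _
          change _ = (if 0 = (l : ℕ) then 1 else 0)
          fin_cases l <;> simp
        · rw [Matrix.blockDiagonal'_apply_ne _ _ _ (by simpa using Ne.symm hij)]
          simp [hij]
      · rw [Matrix.blockDiagonal'_apply_ne _ _ _ (by simp)]
        simp [v, hzB]
    · exact Fin.elim0 (show Fin 0 from k)
  · have hu : (Finset.univ : Finset (Fin w ⊕ Fin r)).val.map blk =
        Multiset.replicate w (JKBlock.horizontal 2) +
          Multiset.replicate r (JKBlock.horizontal 1) := by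
      rw [← Finset.univ_disjSum_univ, Finset.val_disjSum, Multiset.disjSum, Multiset.map_add,
        Multiset.map_map, Multiset.map_map]
      simp [blk, Function.comp_def]
    rw [hu]
    simp only [AlgebraicType.ofBlocks, Multiset.filterMap_add]
    rw [filterMap_replicate_of_eq_none (F := JKBlock.jordanData?) rfl,
      filterMap_replicate_of_eq_none (F := JKBlock.jordanData?) rfl,
      filterMap_replicate_of_eq_none (F := JKBlock.verticalIndex?) rfl,
      filterMap_replicate_of_eq_none (F := JKBlock.verticalIndex?) rfl,
      filterMap_replicate_of_eq_some (F := JKBlock.horizontalIndex?) rfl,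
      filterMap_replicate_of_eq_some (F := JKBlock.horizontalIndex?) rfl]
    simp [add_comm]

/-! ### Skew forms and the action of matrix units -/

/-- Skew-symmetric matrices are determined by their entries below the diagonal. -/
noncomputable def skewFormsEquiv (K : Type*) [Field K] [CharZero K] (N : ℕ) :
    skewForms (Fin N) K ≃ₗ[K] ((Σ i : Fin N, Fin i) → K) where
  toFun Q x := Q.1 x.1 (x.2.castLE x.1.2.le)
  map_add' _ _ := rfl
  map_smul' _ _ := rfl
  invFun a := ⟨Matrix.of fun i j =>
    if h : j < i then a ⟨i, j, h⟩ else if h : i < j then -a ⟨j, i, h⟩ else 0, by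
      change Matrix.transpose _ = -_
      ext i j
      rcases lt_trichotomy i j with h | rfl | h
      · simp [h, h.not_gt]
      · simp
      · simp [h, h.not_gt]⟩
  left_inv Q := by
    have hQ : ∀ i j, Q.1 j i = -Q.1 i j := fun i j => congrFun (congrFun Q.2 i) j
    ext i j
    rcases lt_trichotomy i j with h | rfl | h
    · simp [h, h.not_gt, hQ i j]
    · have : (2 : K) * Q.1 i i = 0 := by linear_combination hQ i i
      simpa [eq_comm] using this
    · simp [h]
  right_inv a := by
    ext ⟨i, j⟩
    have : j.castLE i.2.le < i := j.2
    simp [this]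

instance (K : Type*) [Field K] [CharZero K] (N : ℕ) :
    FiniteDimensional K (skewForms (Fin N) K) :=
  (skewFormsEquiv K N).symm.finiteDimensional

theorem finrank_skewForms (K : Type*) [Field K] [CharZero K] (n : ℕ) :
    Module.finrank K (skewForms (Fin (2 * n + 1)) K) = n * (2 * n + 1) := by
  rw [(skewFormsEquiv K _).finrank_eq, Module.finrank_fintype_fun_eq_card, Fintype.card_sigma]
  simp only [Fintype.card_fin]
  rw [Fin.sum_univ_eq_sum_range (fun i => i)]
  have := Finset.sum_range_id_mul_two (2 * n + 1)
  rw [Nat.add_sub_cancel] at this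
  linarith

/-- The skew form `E k l - E l k`; it vanishes if `k` or `l` is out of range. -/
def skewUnit (K : Type*) [Field K] (N k l : ℕ) : skewForms (Fin N) K :=
  ⟨Matrix.of fun i j =>
    (if (i : ℕ) = k ∧ (j : ℕ) = l then 1 else 0) - if (i : ℕ) = l ∧ (j : ℕ) = k then 1 else 0, by
    change Matrix.transpose _ = -_
    ext i j
    simp [and_comm]⟩

/-- The skew form of a path graph restricted to the edges `{a, a + 1}` with `a % 2 = r`. -/
def chainForm (K : Type*) [Field K] (N r : ℕ) : skewForms (Fin N) K :=
  ⟨Matrix.of fun i j =>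
    (if (j : ℕ) = i + 1 ∧ (i : ℕ) % 2 = r then 1 else 0) -
      if (i : ℕ) = j + 1 ∧ (j : ℕ) % 2 = r then 1 else 0, by
    change Matrix.transpose _ = -_
    ext i j
    simp⟩

theorem skewUnit_swap (K : Type*) [Field K] (N k l : ℕ) :
    skewUnit K N k l = -skewUnit K N l k := by
  ext i j
  simp [skewUnit]

theorem skewUnit_eq_zero (K : Type*) [Field K] {N l : ℕ} (k : ℕ) (h : N ≤ l) :
    skewUnit K N k l = 0 := by
  ext i j
  have hi : (i : ℕ) ≠ l := by omega
  have hj : (j : ℕ) ≠ l := by omega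
  simp [skewUnit, hi, hj]

/-- The pairs `(k, l)` and `(l, k)` contribute equally, whence the factor `1/2`. -/
theorem eq_sum_skewUnit {K : Type*} [Field K] [CharZero K] {N : ℕ} (Q : skewForms (Fin N) K) :
    Q = (2⁻¹ : K) • ∑ k : Fin N, ∑ l : Fin N, Q.1 k l • skewUnit K N k l := by
  have hQ : ∀ i j, Q.1 j i = -Q.1 i j := fun i j => congrFun (congrFun Q.2 i) j
  ext i j
  simp only [skewUnit, ← Fin.ext_iff, ite_and, Submodule.coe_smul, Submodule.coe_sum,
    Matrix.smul_apply, Matrix.sum_apply, Matrix.of_apply, smul_eq_mul, mul_sub,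
    Finset.sum_sub_distrib]
  simp [hQ i j]
  ring

/-- The result is `e_k ∧ (row l of Q)`, a single `skewUnit` up to sign when row `l` is a signed
basis vector. -/
theorem glCongr_single_apply {K : Type*} [Field K] {N : ℕ} (k l : Fin N)
    (Q : skewForms (Fin N) K) (i j : Fin N) :
    (glCongr (Fin N) K (Matrix.single k l 1) Q).1 i j =
      (if i = k then Q.1 l j else 0) - if j = k then Q.1 l i else 0 := by
  have hQ : ∀ i, Q.1 i l = -Q.1 l i := fun i => congrFun (congrFun Q.2 l) i
  change (Matrix.single k l 1 * Q.1 + Q.1 * (Matrix.single k l 1).transpose :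
    Matrix (Fin N) (Fin N) K) i j = _
  rw [Matrix.transpose_single, Matrix.add_apply]
  by_cases hi : i = k <;> by_cases hj : j = k <;>
    simp [Matrix.single_mul_apply_of_ne, Matrix.mul_single_apply_of_ne, hi, hj, hQ, sub_eq_add_neg]

/-- In a `chainForm` every vertex `l` lies on at most one edge: up to `l + 1`, down to `l - 1`, or
none. If `l` is the last vertex, the edge up is missing and `skewUnit` vanishes accordingly. -/
theorem glCongr_single_chainForm_same {K : Type*} [Field K] {N r : ℕ} (k l : Fin N)
    (h : (l : ℕ) % 2 = r) :
    glCongr (Fin N) K (Matrix.single k l 1) (chainForm K N r) = skewUnit K N k (l + 1) := by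
  ext i j
  rw [glCongr_single_apply]
  simp only [chainForm, skewUnit, Matrix.of_apply, Fin.ext_iff]
  have hi : ¬ ((l : ℕ) = i + 1 ∧ (i : ℕ) % 2 = r) := by omega
  have hj : ¬ ((l : ℕ) = j + 1 ∧ (j : ℕ) % 2 = r) := by omega
  simp only [hi, hj, h, if_false, and_true, sub_zero, ite_and]
  split_ifs <;> rfl

theorem glCongr_single_chainForm_ne {K : Type*} [Field K] {N r m : ℕ} (k l : Fin N)
    (h : (l : ℕ) = m + 1) (hm : m % 2 = r) :
    glCongr (Fin N) K (Matrix.single k l 1) (chainForm K N r) = -skewUnit K N k m := by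
  ext i j
  rw [glCongr_single_apply]
  simp only [chainForm, skewUnit, Matrix.of_apply, Fin.ext_iff, Submodule.coe_neg,
    Matrix.neg_apply]
  have hl : ¬ (l : ℕ) % 2 = r := by omega
  have hi : ((l : ℕ) = i + 1 ∧ (i : ℕ) % 2 = r) ↔ (i : ℕ) = m := by omega
  have hj : ((l : ℕ) = j + 1 ∧ (j : ℕ) % 2 = r) ↔ (j : ℕ) = m := by omega
  simp only [hi, hj, hl, if_false, and_false, zero_sub, ite_and]
  split_ifs <;> simp

theorem glCongr_single_zero_chainForm_one {K : Type*} [Field K] {N : ℕ} (k l : Fin N)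
    (h : (l : ℕ) = 0) :
    glCongr (Fin N) K (Matrix.single k l 1) (chainForm K N 1) = 0 := by
  ext i j
  rw [glCongr_single_apply]
  simp [chainForm, h]

/-! ### Surjectivity at the standard pair -/

/-- The tangent space to the `SL`-orbit of the standard pair of skew forms is everything. -/
theorem surjective_slCongr_chainForm (K : Type*) [Field K] [CharZero K] (n : ℕ) :
    Function.Surjective
      ((repOperator (slCongr (Fin (2 * n + 1)) K) (chainForm K _ 0)).prod
        (repOperator (slCongr (Fin (2 * n + 1)) K) (chainForm K _ 1))) := by
  classical
  rw [← LinearMap.range_eq_top]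
  by_contra hne
  obtain ⟨f, hf0, hf⟩ := Submodule.exists_le_ker_of_lt_top _ (lt_top_iff_ne_top.2 hne)
  let G : Matrix (Fin (2 * n + 1)) (Fin (2 * n + 1)) K →ₗ[K] K :=
    f ∘ₗ (repOperator (glCongr (Fin (2 * n + 1)) K) (chainForm K _ 0)).prod
      (repOperator (glCongr (Fin (2 * n + 1)) K) (chainForm K _ 1))
  have hG : ∀ X : Matrix (Fin (2 * n + 1)) (Fin (2 * n + 1)) K, X.trace = 0 → G X = 0 := by
    intro X hX
    have hX' : X ∈ LieAlgebra.SpecialLinear.sl (Fin (2 * n + 1)) K := hX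
    exact hf ⟨⟨X, hX'⟩, rfl⟩
  -- A functional on `gl` vanishing on `sl` is a multiple of the trace; the factor is read off at `E
  -- 0 0`.
  have hG1 : ∀ k l, G (Matrix.single k l 1) = if k = l then G (Matrix.single 0 0 1) else 0 := by
    intro k l
    split_ifs with h
    · subst h
      rw [← sub_eq_zero, ← map_sub]
      apply hG
      simp
    · exact hG _ (Matrix.trace_single_eq_of_ne _ _ _ h)
  have hGs : ∀ k l (P Q : skewForms (Fin (2 * n + 1)) K),
      glCongr _ K (Matrix.single k l 1) (chainForm K _ 0) = P →
      glCongr _ K (Matrix.single k l 1) (chainForm K _ 1) = Q →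
      f (P, 0) + f (0, Q) = if (k : ℕ) = l then G (Matrix.single 0 0 1) else 0 := by
    rintro k l P Q rfl rfl
    rw [← map_add, Prod.mk_add_mk, add_zero, zero_add]
    exact (hG1 k l).trans (by simp only [Fin.ext_iff])
  -- `h0`, `h1`, `h2` come from the units `E k l` with `l = 0`, `l = 2m + 2`, `l = 2m + 1`, which
  -- exhaust the columns.
  have key := eq_zero_of_skew_recurrence (n := n) (c := G (Matrix.single 0 0 1))
    (p := fun k l => f (skewUnit K _ k l, 0)) (q := fun k l => f (0, skewUnit K _ k l))
    (fun k l => by rw [skewUnit_swap, ← map_neg]; simp)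
    (fun k l => by rw [skewUnit_swap, ← map_neg]; simp)
    (fun k l h => by rw [skewUnit_eq_zero K k h]; exact map_zero f)
    (fun k l h => by rw [skewUnit_eq_zero K k h]; exact map_zero f)
    (fun k hk => by
      have := hGs ⟨k, by omega⟩ ⟨0, by omega⟩ _ _ (glCongr_single_chainForm_same _ _ rfl)
        (glCongr_single_zero_chainForm_one _ _ rfl)
      rw [← Prod.zero_eq_mk, map_zero, add_zero] at this
      exact this)
    (fun k m hk hm => by
      have := hGs ⟨k, by omega⟩ ⟨2 * m + 2, by omega⟩ _ _
        (glCongr_single_chainForm_same _ _ (by simp))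
        (glCongr_single_chainForm_ne (m := 2 * m + 1) _ _ rfl (by omega))
      rw [← this, sub_eq_add_neg, ← map_neg]
      simp)
    (fun k m hk hm => by
      have := hGs ⟨k, by omega⟩ ⟨2 * m + 1, by omega⟩ _ _
        (glCongr_single_chainForm_ne (m := 2 * m) _ _ rfl (by omega))
        (glCongr_single_chainForm_same _ _ (by simp))
      rw [← this, ← map_neg]
      simp)
  apply hf0
  refine LinearMap.prod_ext ?_ ?_
  · ext1 Q
    rw [eq_sum_skewUnit Q]
    simp only [map_smul, map_sum, LinearMap.comp_apply, LinearMap.inl_apply, key.1]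
    simp
  · ext1 Q
    rw [eq_sum_skewUnit Q]
    simp only [map_smul, map_sum, LinearMap.comp_apply, LinearMap.inr_apply, key.2]
    simp

/-! ### Dimension count and conclusion -/

/-- If `(R_a, R_b)` is surjective for one pair `(a, b)`, then the Jordan–Kronecker invariants
consist of horizontal indices `1` and `2`. -/
theorem isJKInvariant_of_surjective {K L W : Type*} [Field K] [LieRing L] [LieAlgebra K L]
    [FiniteDimensional K L] [AddCommGroup W] [Module K W] [FiniteDimensional K W]
    (ρ : L →ₗ⁅K⁆ Module.End K W) {a b : W}
    (h : Function.Surjective ((repOperator ρ a).prod (repOperator ρ b))) {r w : ℕ}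
    (hw : Module.finrank K W = w) (hL : Module.finrank K L = 2 * w + r) :
    IsJKInvariant ρ ⟨0, Multiset.replicate r 1 + Multiset.replicate w 2, 0⟩ := by
  let Φ : W × W →ₗ[K] L →ₗ[K] W × W :=
    { toFun := fun x => (repOperator ρ x.1).prod (repOperator ρ x.2)
      map_add' := fun x y => by ext <;> simp [repOperator]
      map_smul' := fun c x => by ext <;> simp [repOperator] }
  exact (holdsGenerically_surjective Φ (x₀ := (a, b)) h).mono fun _ hx =>
    hasAlgebraicType_of_surjective_prod hx hw hL

theorem finrank_sl (K : Type*) [Field K] (n : ℕ) :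
    Module.finrank K (LieAlgebra.SpecialLinear.sl (Fin (n + 1)) K) + 1 = (n + 1) * (n + 1) := by
  have h := (Matrix.traceLinearMap (Fin (n + 1)) K K).finrank_range_add_finrank_ker
  have hs : LinearMap.range (Matrix.traceLinearMap (Fin (n + 1)) K K) = ⊤ :=
    LinearMap.range_eq_top.2 fun c => ⟨Matrix.single 0 0 c, by simp⟩
  rw [hs, finrank_top, Module.finrank_self, Module.finrank_matrix] at h
  simp only [Fintype.card_fin, Module.finrank_self, mul_one] at h
  rw [← h, add_comm]
  -- `sl` is by definition the kernel of the trace.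
  rfl

theorem theoremT {K : Type*} [Field K] [IsAlgClosed K] [CharZero K] (n : ℕ) :
    (∃ T : AlgebraicType, IsJKInvariant (glCongr (Fin (2 * n + 1)) K) T ∧
      T.jordan = 0 ∧ T.vertical = 0 ∧
      T.horizontal =
        Multiset.replicate (2 * n + 1) 1 + Multiset.replicate (n * (2 * n + 1)) 2 ∧
      Multiset.card T.horizontal = n * (2 * n + 3) + 1) ∧
    (∃ T : AlgebraicType, IsJKInvariant (slCongr (Fin (2 * n + 1)) K) T ∧
      T.jordan = 0 ∧ T.vertical = 0 ∧
      T.horizontal =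
        Multiset.replicate (2 * n) 1 + Multiset.replicate (n * (2 * n + 1)) 2 ∧
      Multiset.card T.horizontal = n * (2 * n + 3)) := by
  have hs := surjective_slCongr_chainForm K n
  have hg : Function.Surjective
      ((repOperator (glCongr (Fin (2 * n + 1)) K) (chainForm K _ 0)).prod
        (repOperator (glCongr (Fin (2 * n + 1)) K) (chainForm K _ 1))) := fun y => by
    obtain ⟨X, hX⟩ := hs y
    exact ⟨X.1, hX⟩
  have hd := finrank_sl K (2 * n)
  refine ⟨⟨_, isJKInvariant_of_surjective _ hg (finrank_skewForms K n) (r := 2 * n + 1) ?_,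
    rfl, rfl, rfl, ?_⟩, ⟨_, isJKInvariant_of_surjective _ hs (finrank_skewForms K n) (r := 2 * n) ?_,
    rfl, rfl, rfl, ?_⟩⟩
  · rw [Module.finrank_matrix]
    simp
    ring
  · simp
    ring
  · linarith
  · simp
    ring
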